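/- Let $\mathcal M$ be a duoidal category: a category with two monoidal structures $(\circ,I)$ and $(\bullet,J)$ and a natural interchange law $\zeta_{A,B,C,D}:(A\bullet B)\circ(C\bullet D)\to(A\circ C)\bullet(B\circ D)$, together with a monoid structure $(J,\varpi:J\circ J\to J,\tau:I\to J)$ in $(\mathcal M,\circ,I)$ and a comonoid structure $(I,\delta:I\to I\bullet I,\tau:I\to J)$ in $(\mathcal M,\bullet,J)$ (with the same $\tau$), satisfying the usual two associativity and four unitality axioms. Let $\mathcal M^I$ be the category of right comodules over the comonoid $I$ in $(\mathcal M,\bullet,J)$ and $\mathcal M_J$ the category of right modules over the monoid $J$ in $(\mathcal M,\circ,I)$. Assume that idempotent morphisms in $\mathcal M$ split and that the functor $$H:\ \mathcal M^I\xrightarrow{\ U^I\ }\mathcal M\xrightarrow{\ (-)\circ J\ }\mathcal M_J$$ (forget the coaction, then form the free $J$-module) is comonadic, i.e. it has a right adjoint and its comparison functor to the category of coalgebras of the induced comonad on $\mathcal M_J$ is an equivalence. Let $A$ be a bimonoid in $\mathcal M$: a monoid $(A,\mu,\eta)$ in $(\mathcal M,\circ,I)$ and a comonoid $(A,\Delta,\varepsilon)$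 in $(\mathcal M,\bullet,J)$ such that $\Delta\mu=(\mu\bullet\mu)\,\zeta\,(\Delta\circ\Delta)$, $\varepsilon\mu=\varpi(\varepsilon\circ\varepsilon)$, $\Delta\eta=(\eta\bullet\eta)\delta$ and $\varepsilon\eta=\tau$. Let $\mathcal M^A_A$ be the category of $A$-Hopf modules: its objects are the triples $(X,\gamma:X\circ A\to X,\rho:X\to X\bullet A)$ in which $\gamma$ is an associative and unital action, $\rho$ is a coassociative and counital coaction, and $\rho\gamma=(\gamma\bullet\mu)\,\zeta\,(\rho\circ\Delta)$; its morphisms are the morphisms of both modules and comodules. Let $$K=(-)\circ A:\ \mathcal M^I\to\mathcal M^A_A$$ send an $I$-comodule $(Z,\rho)$ to $Z\circ A$ with the action $(Z\circ A)\circ A\cong Z\circ(A\circ A)\xrightarrow{Z\circ\mu}Z\circ A$ and the coaction $$Z\circ A\xrightarrow{\rho\circ\Delta}(Z\bullet I)\circ(A\bullet A)\xrightarrow{\ \zeta\ }(Z\circ A)\bullet(I\circ A)\cong(Z\circ A)\bullet A.$$ If the natural transformation $\beta$ whose component at a right $A$-module $(Q,\gamma)$ is $$\beta_Q:\ (Q\bullet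 I)\circ A\xrightarrow{(Q\bullet I)\circ\Delta}(Q\bullet I)\circ(A\bullet A)\xrightarrow{\ \zeta\ }(Q\circ A)\bullet(I\circ A)\cong(Q\circ A)\bullet A\xrightarrow{\gamma\bullet A}Q\bullet A$$ is an isomorphism, then $K$ is fully faithful. -/

import Mathlib

open CategoryTheory

universe v u

/-! ## Right modules and right comodules in a monoidal category -/

section OneProduct

open MonoidalCategory

variable {C : Type u} [Category.{v} C] [MonoidalCategory C]

/-- The monad `(-) ⊗ A` of a monoid `A`. Its Eilenberg–Moore algebras are the right `A`-modules. -/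
def rightModuleMonad (A : C) [MonObj A] : Monad C where
  toFunctor := tensorRight A
  η := { app := fun X => (ρ_ X).inv ≫ X ◁ (MonObj.one : 𝟙_ C ⟶ A)
         naturality := fun X Y f => by simp [whisker_exchange] }
  μ := { app := fun X => (α_ X A A).hom ≫ X ◁ (MonObj.mul : A ⊗ A ⟶ A)
         naturality := fun X Y f => by simp [whisker_exchange] }
  assoc X := by
    simp [← MonoidalCategory.whiskerLeft_comp, MonObj.mul_assoc]
    simp
  left_unit X := by
    simp [← MonoidalCategory.whiskerLeft_comp]
  right_unit X := by
    simp [← MonoidalCategory.whiskerLeft_comp]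

/-- The comonad `(-) ⊗ A` of a comonoid `A`. Its Eilenberg–Moore coalgebras are the right
`A`-comodules. -/
def rightComoduleComonad (A : C) [ComonObj A] : Comonad C where
  toFunctor := tensorRight A
  ε := { app := fun X => X ◁ (ComonObj.counit : A ⟶ 𝟙_ C) ≫ (ρ_ X).hom
         naturality := fun X Y f => by
          simp [← whisker_exchange_assoc] }
  δ := { app := fun X => X ◁ (ComonObj.comul : A ⟶ A ⊗ A) ≫ (α_ X A A).inv
         naturality := fun X Y f => by
          simp [← whisker_exchange_assoc] }
  coassoc X := by
    have h : X ◁ (ComonObj.comul : A ⟶ A ⊗ A) ≫ X ◁ A ◁ (ComonObj.comul : A ⟶ A ⊗ A) =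
        X ◁ (ComonObj.comul : A ⟶ A ⊗ A) ≫ X ◁ (ComonObj.comul : A ⟶ A ⊗ A) ▷ A ≫
          X ◁ (α_ A A A).hom := by
      simp only [← MonoidalCategory.whiskerLeft_comp, ComonObj.comul_assoc]
    simp [reassoc_of% h]
  left_counit X := by
    have h : X ◁ (ComonObj.comul : A ⟶ A ⊗ A) ≫ X ◁ A ◁ (ComonObj.counit : A ⟶ 𝟙_ C) =
        X ◁ (ρ_ A).inv := by
      simp only [← MonoidalCategory.whiskerLeft_comp, ComonObj.comul_counit]
    simp [reassoc_of% h]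
  right_counit X := by
    have h : X ◁ (ComonObj.comul : A ⟶ A ⊗ A) ≫ X ◁ (ComonObj.counit : A ⟶ 𝟙_ C) ▷ A =
        X ◁ (λ_ A).inv := by
      simp only [← MonoidalCategory.whiskerLeft_comp, ComonObj.counit_comul]
    simp [reassoc_of% h]

end OneProduct

/-! ## Duoidal categories -/

/-- A category with two monoidal structures `(∘, I)` and `(•, J)`, not yet related. The products are
written `X ⊚ Y` and `X ⊛ Y`, the units `𝕀[C]` and `𝕁[C]`. -/
class TwoMonoidalStructures (C : Type u) [Category.{v} C] where
  circ : MonoidalCategory C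
  bullet : MonoidalCategory C

notation:70 X:71 " ⊚ " Y:71 => MonoidalCategoryStruct.tensorObj
  (self := MonoidalCategory.toMonoidalCategoryStruct (self := TwoMonoidalStructures.circ)) X Y
notation:70 X:71 " ⊛ " Y:71 => MonoidalCategoryStruct.tensorObj
  (self := MonoidalCategory.toMonoidalCategoryStruct (self := TwoMonoidalStructures.bullet)) X Y
notation:70 f:71 " ⊚ₘ " g:71 => MonoidalCategoryStruct.tensorHom
  (self := MonoidalCategory.toMonoidalCategoryStruct (self := TwoMonoidalStructures.circ)) f g
notation:70 f:71 " ⊛ₘ " g:71 => MonoidalCategoryStruct.tensorHom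
  (self := MonoidalCategory.toMonoidalCategoryStruct (self := TwoMonoidalStructures.bullet)) f g
notation "𝕀[" C "]" => MonoidalCategoryStruct.tensorUnit C
  (self := MonoidalCategory.toMonoidalCategoryStruct (self := TwoMonoidalStructures.circ))
notation "𝕁[" C "]" => MonoidalCategoryStruct.tensorUnit C
  (self := MonoidalCategory.toMonoidalCategoryStruct (self := TwoMonoidalStructures.bullet))
notation "α∘" => MonoidalCategoryStruct.associator
  (self := MonoidalCategory.toMonoidalCategoryStruct (self := TwoMonoidalStructures.circ))
notation "α•" => MonoidalCategoryStruct.associator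
  (self := MonoidalCategory.toMonoidalCategoryStruct (self := TwoMonoidalStructures.bullet))
notation "λ∘" => MonoidalCategoryStruct.leftUnitor
  (self := MonoidalCategory.toMonoidalCategoryStruct (self := TwoMonoidalStructures.circ))
notation "λ•" => MonoidalCategoryStruct.leftUnitor
  (self := MonoidalCategory.toMonoidalCategoryStruct (self := TwoMonoidalStructures.bullet))
notation "ρ∘" => MonoidalCategoryStruct.rightUnitor
  (self := MonoidalCategory.toMonoidalCategoryStruct (self := TwoMonoidalStructures.circ))
notation "ρ•" => MonoidalCategoryStruct.rightUnitor
  (self := MonoidalCategory.toMonoidalCategoryStruct (self := TwoMonoidalStructures.bullet))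

/-- A duoidal (2-monoidal) category. -/
class DuoidalCategory (C : Type u) [Category.{v} C] extends TwoMonoidalStructures C where
  /-- the monoid `(J, ϖ, τ)` in `(C, ∘, I)` -/
  monJ : @MonObj C _ circ (𝕁[C])
  /-- the comonoid `(I, δ, τ)` in `(C, •, J)` -/
  comonI : @ComonObj C _ bullet (𝕀[C])
  /-- the unit of `J` and the counit of `I` are the same morphism `τ : I ⟶ J` -/
  counit_comonI : comonI.counit = monJ.one
  /-- the interchange law -/
  zeta (X Y Z W : C) : (X ⊛ Y) ⊚ (Z ⊛ W) ⟶ (X ⊚ Z) ⊛ (Y ⊚ W)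
  zeta_natural {X X' Y Y' Z Z' W W' : C} (f : X ⟶ X') (g : Y ⟶ Y') (h : Z ⟶ Z') (k : W ⟶ W') :
    ((f ⊛ₘ g) ⊚ₘ (h ⊛ₘ k)) ≫ zeta X' Y' Z' W' = zeta X Y Z W ≫ ((f ⊚ₘ h) ⊛ₘ (g ⊚ₘ k))
  zeta_circ_assoc (X Y Z W U V : C) :
    (zeta X Y Z W ⊚ₘ 𝟙 (U ⊛ V)) ≫ zeta (X ⊚ Z) (Y ⊚ W) U V ≫
        ((α∘ X Z U).hom ⊛ₘ (α∘ Y W V).hom) =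
      (α∘ (X ⊛ Y) (Z ⊛ W) (U ⊛ V)).hom ≫ (𝟙 (X ⊛ Y) ⊚ₘ zeta Z W U V) ≫
        zeta X Y (Z ⊚ U) (W ⊚ V)
  zeta_bullet_assoc (X Y Z W U V : C) :
    zeta (X ⊛ Y) Z (W ⊛ U) V ≫ (zeta X Y W U ⊛ₘ 𝟙 (Z ⊚ V)) ≫
        (α• (X ⊚ W) (Y ⊚ U) (Z ⊚ V)).hom =
      ((α• X Y Z).hom ⊚ₘ (α• W U V).hom) ≫ zeta X (Y ⊛ Z) W (U ⊛ V) ≫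
        (𝟙 (X ⊚ W) ⊛ₘ zeta Y Z U V)
  zeta_left_I (X Y : C) :
    (comonI.comul ⊚ₘ 𝟙 (X ⊛ Y)) ≫ zeta (𝕀[C]) (𝕀[C]) X Y ≫ ((λ∘ X).hom ⊛ₘ (λ∘ Y).hom) =
      (λ∘ (X ⊛ Y)).hom
  zeta_right_I (X Y : C) :
    (𝟙 (X ⊛ Y) ⊚ₘ comonI.comul) ≫ zeta X Y (𝕀[C]) (𝕀[C]) ≫ ((ρ∘ X).hom ⊛ₘ (ρ∘ Y).hom) =
      (ρ∘ (X ⊛ Y)).hom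
  zeta_left_J (X Y : C) :
    zeta (𝕁[C]) X (𝕁[C]) Y ≫ (monJ.mul ⊛ₘ 𝟙 (X ⊚ Y)) ≫ (λ• (X ⊚ Y)).hom =
      (λ• X).hom ⊚ₘ (λ• Y).hom
  zeta_right_J (X Y : C) :
    zeta X (𝕁[C]) Y (𝕁[C]) ≫ (𝟙 (X ⊚ Y) ⊛ₘ monJ.mul) ≫ (ρ• (X ⊚ Y)).hom =
      (ρ• X).hom ⊚ₘ (ρ• Y).hom

namespace DuoidalCategory

variable {C : Type u} [Category.{v} C] [DuoidalCategory C]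

variable (C) in
/-- `δ : I ⟶ I • I` -/
abbrev delta : 𝕀[C] ⟶ 𝕀[C] ⊛ 𝕀[C] := (comonI (C := C)).comul

variable (C) in
/-- `ϖ : J ∘ J ⟶ J` -/
abbrev varpi : 𝕁[C] ⊚ 𝕁[C] ⟶ 𝕁[C] := (monJ (C := C)).mul

variable (C) in
/-- `τ : I ⟶ J` -/
abbrev tau : 𝕀[C] ⟶ 𝕁[C] := (monJ (C := C)).one

/-- A bimonoid in a duoidal category: a monoid for `∘` and a comonoid for `•`, compatible. -/
class BimonoidObj (A : C) where
  mon : @MonObj C _ TwoMonoidalStructures.circ A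
  comon : @ComonObj C _ TwoMonoidalStructures.bullet A
  mul_comul : mon.mul ≫ comon.comul =
    (comon.comul ⊚ₘ comon.comul) ≫ zeta A A A A ≫ (mon.mul ⊛ₘ mon.mul)
  mul_counit : mon.mul ≫ comon.counit = (comon.counit ⊚ₘ comon.counit) ≫ varpi C
  one_comul : mon.one ≫ comon.comul = delta C ≫ (mon.one ⊛ₘ mon.one)
  one_counit : mon.one ≫ comon.counit = tau C

/-- `μ : A ∘ A ⟶ A` -/
abbrev mul (A : C) [BimonoidObj A] : A ⊚ A ⟶ A := (BimonoidObj.mon (A := A)).mul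

/-- `η : I ⟶ A` -/
abbrev one (A : C) [BimonoidObj A] : 𝕀[C] ⟶ A := (BimonoidObj.mon (A := A)).one

/-- `Δ : A ⟶ A • A` -/
abbrev comul (A : C) [BimonoidObj A] : A ⟶ A ⊛ A := (BimonoidObj.comon (A := A)).comul

/-- `ε : A ⟶ J` -/
abbrev counit (A : C) [BimonoidObj A] : A ⟶ 𝕁[C] := (BimonoidObj.comon (A := A)).counit

/-! ### The categories `M_A`, `M_J`, `M^I`, and the functor `H` -/

/-- The monad `(-) ∘ A` on `C`; the category `M_A` of right `A`-modules is `(modMonad A).Algebra`. -/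
abbrev modMonad (A : C) [BimonoidObj A] : Monad C :=
  @rightModuleMonad C _ TwoMonoidalStructures.circ A BimonoidObj.mon

variable (C) in
/-- The monad `(-) ∘ J` on `C`; the category `M_J` of right `J`-modules is `(monadJ C).Algebra`. -/
abbrev monadJ : Monad C :=
  @rightModuleMonad C _ TwoMonoidalStructures.circ (𝕁[C]) monJ

variable (C) in
/-- The comonad `(-) • I` on `C`; the category `M^I` of right `I`-comodules is
`(comonadI C).Coalgebra`. -/
abbrev comonadI : Comonad C :=
  @rightComoduleComonad C _ TwoMonoidalStructures.bullet (𝕀[C]) comonI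

variable (C) in
/-- The functor `H : M^I ⥤ M_J`, the forgetful functor followed by the free module functor
`(-) ∘ J`. -/
abbrev functorH : (comonadI C).Coalgebra ⥤ (monadJ C).Algebra :=
  (comonadI C).forget ⋙ (monadJ C).free

/-! ### Elementary calculus of the two products -/

section Calculus

variable {X X' X'' Y Y' Y'' Z Z' : C}

theorem circ_comp (f : X ⟶ X') (f' : X' ⟶ X'') (g : Y ⟶ Y') (g' : Y' ⟶ Y'') :
    (f ⊚ₘ g) ≫ (f' ⊚ₘ g') = (f ≫ f') ⊚ₘ (g ≫ g') :=
  letI := TwoMonoidalStructures.circ (C := C)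
  MonoidalCategory.tensorHom_comp_tensorHom f g f' g'

theorem bullet_comp (f : X ⟶ X') (f' : X' ⟶ X'') (g : Y ⟶ Y') (g' : Y' ⟶ Y'') :
    (f ⊛ₘ g) ≫ (f' ⊛ₘ g') = (f ≫ f') ⊛ₘ (g ≫ g') :=
  letI := TwoMonoidalStructures.bullet (C := C)
  MonoidalCategory.tensorHom_comp_tensorHom f g f' g'

theorem circ_id (X Y : C) : 𝟙 X ⊚ₘ 𝟙 Y = 𝟙 (X ⊚ Y) :=
  letI := TwoMonoidalStructures.circ (C := C)
  MonoidalCategory.id_tensorHom_id X Y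

theorem bullet_id (X Y : C) : 𝟙 X ⊛ₘ 𝟙 Y = 𝟙 (X ⊛ Y) :=
  letI := TwoMonoidalStructures.bullet (C := C)
  MonoidalCategory.id_tensorHom_id X Y

theorem circ_assoc_natural (f : X ⟶ X') (g : Y ⟶ Y') (h : Z ⟶ Z') :
    ((f ⊚ₘ g) ⊚ₘ h) ≫ (α∘ X' Y' Z').hom = (α∘ X Y Z).hom ≫ (f ⊚ₘ (g ⊚ₘ h)) :=
  letI := TwoMonoidalStructures.circ (C := C)
  MonoidalCategory.associator_naturality f g h

theorem tau_eq : (comonI (C := C)).counit = tau C := counit_comonI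

theorem circ_left_natural (f : X ⟶ Y) :
    (𝟙 (𝕀[C]) ⊚ₘ f) ≫ (λ∘ Y).hom = (λ∘ X).hom ≫ f := by
  let _ := TwoMonoidalStructures.circ (C := C)
  simp

end Calculus

/-! ### Hopf modules -/

/-- A (right-right) Hopf module over the bimonoid `A`. -/
structure HopfModule (A : C) [BimonoidObj A] where
  X : C
  act : X ⊚ A ⟶ X
  coact : X ⟶ X ⊛ A
  act_one : (𝟙 X ⊚ₘ one A) ≫ act = (ρ∘ X).hom
  act_assoc : (act ⊚ₘ 𝟙 A) ≫ act = (α∘ X A A).hom ≫ (𝟙 X ⊚ₘ mul A) ≫ act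
  coact_counit : coact ≫ (𝟙 X ⊛ₘ counit A) = (ρ• X).inv
  coact_coassoc : coact ≫ (coact ⊛ₘ 𝟙 A) ≫ (α• X A A).hom = coact ≫ (𝟙 X ⊛ₘ comul A)
  act_coact : act ≫ coact = (coact ⊚ₘ comul A) ≫ zeta X A A A ≫ (act ⊛ₘ mul A)

namespace HopfModule

variable {A : C} [BimonoidObj A]

/-- Morphisms of Hopf modules are the morphisms of both modules and comodules. -/
@[ext]
structure Hom (X Y : HopfModule A) where
  f : X.X ⟶ Y.X
  act_f : X.act ≫ f = (f ⊚ₘ 𝟙 A) ≫ Y.act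
  f_coact : f ≫ Y.coact = X.coact ≫ (f ⊛ₘ 𝟙 A)

instance : Category (HopfModule A) where
  Hom := Hom
  id X :=
    { f := 𝟙 X.X
      act_f := by rw [circ_id, Category.comp_id, Category.id_comp]
      f_coact := by rw [bullet_id, Category.comp_id, Category.id_comp] }
  comp {X Y Z} g h :=
    { f := g.f ≫ h.f
      act_f := by
        rw [← Category.assoc, g.act_f, Category.assoc, h.act_f, reassoc_of% @circ_comp, Category.comp_id]
      f_coact := by
        rw [Category.assoc, h.f_coact, ← Category.assoc, g.f_coact, Category.assoc, bullet_comp,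
          Category.comp_id] }
  id_comp _ := Hom.ext (Category.id_comp _)
  comp_id _ := Hom.ext (Category.comp_id _)
  assoc _ _ _ := Hom.ext (Category.assoc _ _ _)

end HopfModule

/-! ### The functor `K` -/

section K

variable (A : C) [BimonoidObj A]

/-- The coaction `Z ⟶ Z • I` of an `I`-comodule. -/
abbrev coactI (Z : (comonadI C).Coalgebra) : Z.A ⟶ Z.A ⊛ 𝕀[C] := Z.a

theorem coactI_counit (Z : (comonadI C).Coalgebra) :
    coactI Z ≫ (𝟙 Z.A ⊛ₘ tau C) ≫ (ρ• Z.A).hom = 𝟙 Z.A := by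
  have h := Z.counit
  rw [← tau_eq, @MonoidalCategory.id_tensorHom C _ TwoMonoidalStructures.bullet]
  exact h

theorem coactI_coassoc (Z : (comonadI C).Coalgebra) :
    coactI Z ≫ (coactI Z ⊛ₘ 𝟙 (𝕀[C])) ≫ (α• Z.A (𝕀[C]) (𝕀[C])).hom =
      coactI Z ≫ (𝟙 Z.A ⊛ₘ delta C) := by
  have h : coactI Z ≫ (𝟙 Z.A ⊛ₘ delta C) ≫ (α• Z.A (𝕀[C]) (𝕀[C])).inv =
      coactI Z ≫ (coactI Z ⊛ₘ 𝟙 (𝕀[C])) := by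
    rw [@MonoidalCategory.id_tensorHom C _ TwoMonoidalStructures.bullet,
      @MonoidalCategory.tensorHom_id C _ TwoMonoidalStructures.bullet]
    exact Z.coassoc
  rw [← Category.assoc, ← h]
  simp only [Category.assoc, Iso.inv_hom_id, Category.comp_id]

theorem coactI_natural {Z W : (comonadI C).Coalgebra} (f : Z ⟶ W) :
    f.f ≫ coactI W = coactI Z ≫ (f.f ⊛ₘ 𝟙 (𝕀[C])) := by
  rw [@MonoidalCategory.tensorHom_id C _ TwoMonoidalStructures.bullet]
  exact f.h.symm

/-- The natural morphism `(M • I) ∘ A ⟶ (M ∘ A) • A` given by comultiplication and interchange. -/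
def lambda0 (M : C) : (M ⊛ 𝕀[C]) ⊚ A ⟶ (M ⊚ A) ⊛ A :=
  (𝟙 (M ⊛ 𝕀[C]) ⊚ₘ comul A) ≫ zeta M (𝕀[C]) A A ≫ (𝟙 (M ⊚ A) ⊛ₘ (λ∘ A).hom)

/-- The `A`-action on `M ∘ A`. -/
def actK (M : C) : (M ⊚ A) ⊚ A ⟶ M ⊚ A := (α∘ M A A).hom ≫ (𝟙 M ⊚ₘ mul A)

/-- The `A`-coaction on `Z ∘ A` for an `I`-comodule `Z`. -/
def coactK (Z : (comonadI C).Coalgebra) : Z.A ⊚ A ⟶ (Z.A ⊚ A) ⊛ A :=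
  (coactI Z ⊚ₘ 𝟙 A) ≫ lambda0 A Z.A

theorem coactK_eq (Z : (comonadI C).Coalgebra) :
    coactK A Z = (coactI Z ⊚ₘ comul A) ≫ zeta Z.A (𝕀[C]) A A ≫
      (𝟙 (Z.A ⊚ A) ⊛ₘ (λ∘ A).hom) := by
  rw [coactK, lambda0, reassoc_of% @circ_comp, Category.comp_id, Category.id_comp]

theorem lambda0_natural {M N : C} (f : M ⟶ N) :
    ((f ⊛ₘ 𝟙 (𝕀[C])) ⊚ₘ 𝟙 A) ≫ lambda0 A N = lambda0 A M ≫ ((f ⊚ₘ 𝟙 A) ⊛ₘ 𝟙 A) := by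
  have h := zeta_natural f (𝟙 (𝕀[C])) (𝟙 A) (𝟙 A)
  have e : (f ⊛ₘ 𝟙 (𝕀[C])) ⊚ₘ comul A =
      (𝟙 (M ⊛ 𝕀[C]) ⊚ₘ comul A) ≫ ((f ⊛ₘ 𝟙 (𝕀[C])) ⊚ₘ (𝟙 A ⊛ₘ 𝟙 A)) := by
    rw [circ_comp, bullet_id, Category.id_comp, Category.comp_id]
  simp only [lambda0, Category.assoc, reassoc_of% @circ_comp, bullet_comp, Category.comp_id,
    Category.id_comp]
  rw [e, Category.assoc, reassoc_of% h, bullet_comp, circ_id, Category.id_comp, Category.comp_id]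

theorem leftUnitor_J : (λ∘ (𝕁[C])).hom = (tau C ⊚ₘ 𝟙 (𝕁[C])) ≫ varpi C := by
  rw [@MonoidalCategory.tensorHom_id C _ TwoMonoidalStructures.circ]
  exact (@MonObj.one_mul C _ TwoMonoidalStructures.circ (𝕁[C]) monJ).symm

theorem comul_counit_comp : comul A ≫ (𝟙 A ⊛ₘ counit A) ≫ (ρ• A).hom = 𝟙 A := by
  rw [@MonoidalCategory.id_tensorHom C _ TwoMonoidalStructures.bullet]
  rw [← Category.assoc, @ComonObj.comul_counit C _ TwoMonoidalStructures.bullet A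
    BimonoidObj.comon, Iso.inv_hom_id]

theorem comul_coassoc :
    comul A ≫ (comul A ⊛ₘ 𝟙 A) ≫ (α• A A A).hom = comul A ≫ (𝟙 A ⊛ₘ comul A) := by
  rw [@MonoidalCategory.id_tensorHom C _ TwoMonoidalStructures.bullet,
    @MonoidalCategory.tensorHom_id C _ TwoMonoidalStructures.bullet]
  exact (@ComonObj.comul_assoc C _ TwoMonoidalStructures.bullet A BimonoidObj.comon).symm

theorem coactK_counit (Z : (comonadI C).Coalgebra) :
    coactK A Z ≫ (𝟙 (Z.A ⊚ A) ⊛ₘ counit A) = (ρ• (Z.A ⊚ A)).inv := by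
  rw [← cancel_mono (ρ• (Z.A ⊚ A)).hom, Iso.inv_hom_id, coactK_eq]
  have h1 := zeta_natural (𝟙 Z.A) (𝟙 (𝕀[C])) (𝟙 A) (counit A)
  have h2 := zeta_natural (𝟙 Z.A) (tau C) (𝟙 A) (𝟙 (𝕁[C]))
  rw [circ_id] at h1 h2
  have e : (𝟙 (Z.A ⊚ A) ⊛ₘ (λ∘ A).hom) ≫ (𝟙 (Z.A ⊚ A) ⊛ₘ counit A) =
      (𝟙 (Z.A ⊚ A) ⊛ₘ (𝟙 (𝕀[C]) ⊚ₘ counit A)) ≫ (𝟙 (Z.A ⊚ A) ⊛ₘ (tau C ⊚ₘ 𝟙 (𝕁[C]))) ≫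
        (𝟙 (Z.A ⊚ A) ⊛ₘ varpi C) := by
    rw [bullet_comp, bullet_comp, bullet_comp, Category.comp_id, Category.comp_id,
      ← leftUnitor_J, circ_left_natural]
  simp only [Category.assoc]
  rw [reassoc_of% e, ← reassoc_of% h1, ← reassoc_of% h2, zeta_right_J, circ_comp, circ_comp,
    circ_comp, bullet_id, bullet_id, Category.id_comp, Category.id_comp, ← circ_id,
    comul_counit_comp, coactI_counit]

theorem coactK_coassoc (Z : (comonadI C).Coalgebra) :
    coactK A Z ≫ (coactK A Z ⊛ₘ 𝟙 A) ≫ (α• (Z.A ⊚ A) A A).hom =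
      coactK A Z ≫ (𝟙 (Z.A ⊚ A) ⊛ₘ comul A) := by
  have hL : coactK A Z ≫ (coactK A Z ⊛ₘ 𝟙 A) =
      ((coactI Z ≫ (coactI Z ⊛ₘ 𝟙 (𝕀[C]))) ⊚ₘ (comul A ≫ (comul A ⊛ₘ 𝟙 A))) ≫
        zeta (Z.A ⊛ 𝕀[C]) (𝕀[C]) (A ⊛ A) A ≫
        (zeta Z.A (𝕀[C]) A A ⊛ₘ 𝟙 (𝕀[C] ⊚ A)) ≫
        ((𝟙 (Z.A ⊚ A) ⊛ₘ (λ∘ A).hom) ⊛ₘ (λ∘ A).hom) := by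
    have h := zeta_natural (coactI Z) (𝟙 (𝕀[C])) (comul A) (𝟙 A)
    rw [← circ_comp, Category.assoc, reassoc_of% h, coactK_eq, Category.assoc, Category.assoc]
    simp only [bullet_comp, circ_id, Category.id_comp, Category.comp_id]
  have hR : coactK A Z ≫ (𝟙 (Z.A ⊚ A) ⊛ₘ comul A) =
      ((coactI Z ≫ (𝟙 Z.A ⊛ₘ delta C)) ⊚ₘ (comul A ≫ (𝟙 A ⊛ₘ comul A))) ≫
        zeta Z.A (𝕀[C] ⊛ 𝕀[C]) A (A ⊛ A) ≫
        (𝟙 (Z.A ⊚ A) ⊛ₘ zeta (𝕀[C]) (𝕀[C]) A A) ≫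
        (𝟙 (Z.A ⊚ A) ⊛ₘ ((λ∘ A).hom ⊛ₘ (λ∘ A).hom)) := by
    have h := zeta_natural (𝟙 Z.A) (delta C) (𝟙 A) (comul A)
    have e : (λ∘ A).hom ≫ comul A =
        (delta C ⊚ₘ comul A) ≫ zeta (𝕀[C]) (𝕀[C]) A A ≫ ((λ∘ A).hom ⊛ₘ (λ∘ A).hom) := by
      rw [← circ_left_natural, ← zeta_left_I, reassoc_of% @circ_comp, Category.id_comp, Category.comp_id]
    rw [← circ_comp, Category.assoc, reassoc_of% h, coactK_eq, Category.assoc, Category.assoc]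
    simp only [bullet_comp, circ_id, Category.id_comp, e]
  have hα : ((𝟙 (Z.A ⊚ A) ⊛ₘ (λ∘ A).hom) ⊛ₘ (λ∘ A).hom) ≫ (α• (Z.A ⊚ A) A A).hom =
      (α• (Z.A ⊚ A) (𝕀[C] ⊚ A) (𝕀[C] ⊚ A)).hom ≫
        (𝟙 (Z.A ⊚ A) ⊛ₘ ((λ∘ A).hom ⊛ₘ (λ∘ A).hom)) :=
    @MonoidalCategory.associator_naturality C _ TwoMonoidalStructures.bullet _ _ _ _ _ _ _ _ _
  have hz := zeta_bullet_assoc Z.A (𝕀[C]) (𝕀[C]) A A A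
  rw [← Category.assoc, hL, hR]
  simp only [Category.assoc]
  rw [hα, reassoc_of% hz, reassoc_of% @circ_comp, Category.assoc, Category.assoc, coactI_coassoc,
    comul_coassoc]

theorem actK_coactK (Z : (comonadI C).Coalgebra) :
    actK A Z.A ≫ coactK A Z =
      (coactK A Z ⊚ₘ comul A) ≫ zeta (Z.A ⊚ A) A A A ≫ (actK A Z.A ⊛ₘ mul A) := by
  have hl : (α∘ (𝕀[C]) A A).hom ≫ (𝟙 (𝕀[C]) ⊚ₘ mul A) ≫ (λ∘ A).hom =
      ((λ∘ A).hom ⊚ₘ 𝟙 A) ≫ mul A := by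
    let _ := TwoMonoidalStructures.circ (C := C)
    simp
  have hL : actK A Z.A ≫ coactK A Z =
      ((coactI Z ⊚ₘ comul A) ⊚ₘ comul A) ≫ (α∘ (Z.A ⊛ 𝕀[C]) (A ⊛ A) (A ⊛ A)).hom ≫
        (𝟙 (Z.A ⊛ 𝕀[C]) ⊚ₘ zeta A A A A) ≫ zeta Z.A (𝕀[C]) (A ⊚ A) (A ⊚ A) ≫
        ((𝟙 Z.A ⊚ₘ mul A) ⊛ₘ ((𝟙 (𝕀[C]) ⊚ₘ mul A) ≫ (λ∘ A).hom)) := by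
    have h := zeta_natural (𝟙 Z.A) (𝟙 (𝕀[C])) (mul A) (mul A)
    have e : mul A ≫ comul A = (comul A ⊚ₘ comul A) ≫ zeta A A A A ≫ (mul A ⊛ₘ mul A) :=
      BimonoidObj.mul_comul
    have e2 : (𝟙 Z.A ⊚ₘ mul A) ≫ (coactI Z ⊚ₘ comul A) =
        (coactI Z ⊚ₘ (comul A ⊚ₘ comul A)) ≫ (𝟙 (Z.A ⊛ 𝕀[C]) ⊚ₘ zeta A A A A) ≫
          ((𝟙 Z.A ⊛ₘ 𝟙 (𝕀[C])) ⊚ₘ (mul A ⊛ₘ mul A)) := by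
      rw [circ_comp, circ_comp, circ_comp, bullet_id, e, Category.id_comp, Category.comp_id,
        Category.comp_id]
    rw [actK, coactK_eq, Category.assoc, reassoc_of% e2, reassoc_of% h, bullet_comp,
      Category.comp_id, reassoc_of% @circ_assoc_natural]
  have hz := zeta_circ_assoc Z.A (𝕀[C]) A A A A
  have h3 := zeta_natural (𝟙 (Z.A ⊚ A)) (λ∘ A).hom (𝟙 A) (𝟙 A)
  have e3 : coactK A Z ⊚ₘ comul A =
      ((coactI Z ⊚ₘ comul A) ⊚ₘ comul A) ≫ (zeta Z.A (𝕀[C]) A A ⊚ₘ 𝟙 (A ⊛ A)) ≫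
        ((𝟙 (Z.A ⊚ A) ⊛ₘ (λ∘ A).hom) ⊚ₘ (𝟙 A ⊛ₘ 𝟙 A)) := by
    rw [circ_comp, circ_comp, bullet_id, coactK_eq, Category.comp_id, Category.comp_id]
  rw [hL, e3]
  simp only [Category.assoc]
  rw [← reassoc_of% hz, reassoc_of% h3, bullet_comp, bullet_comp, hl, actK, circ_id,
    Category.id_comp]

theorem actK_one (M : C) : (𝟙 (M ⊚ A) ⊚ₘ one A) ≫ actK A M = (ρ∘ (M ⊚ A)).hom := by
  let _ := TwoMonoidalStructures.circ (C := C)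
  let _ : MonObj A := BimonoidObj.mon
  have h := (rightModuleMonad A).left_unit M
  rw [← cancel_epi (ρ∘ (M ⊚ A)).inv, Iso.inv_hom_id,
    @MonoidalCategory.id_tensorHom C _ TwoMonoidalStructures.circ, actK,
    @MonoidalCategory.id_tensorHom C _ TwoMonoidalStructures.circ]
  exact (Category.assoc _ _ _).symm.trans h

theorem actK_assoc (M : C) :
    (actK A M ⊚ₘ 𝟙 A) ≫ actK A M =
      (α∘ (M ⊚ A) A A).hom ≫ (𝟙 (M ⊚ A) ⊚ₘ mul A) ≫ actK A M := by
  let _ := TwoMonoidalStructures.circ (C := C)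
  let _ : MonObj A := BimonoidObj.mon
  have h := ((modMonad A).free.obj M).assoc
  rw [@MonoidalCategory.tensorHom_id C _ TwoMonoidalStructures.circ,
    @MonoidalCategory.id_tensorHom C _ TwoMonoidalStructures.circ, actK,
    @MonoidalCategory.id_tensorHom C _ TwoMonoidalStructures.circ]
  exact h.symm.trans (Category.assoc _ _ _)

/-- `Z ∘ A` as a Hopf module, for an `I`-comodule `Z`. -/
def functorKObj (Z : (comonadI C).Coalgebra) : HopfModule A where
  X := Z.A ⊚ A
  act := actK A Z.A
  coact := coactK A Z
  act_one := actK_one A Z.A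
  act_assoc := actK_assoc A Z.A
  coact_counit := coactK_counit A Z
  coact_coassoc := coactK_coassoc A Z
  act_coact := actK_coactK A Z

/-- The functor `K = (-) ∘ A : M^I ⥤ M^A_A`. -/
def functorK : (comonadI C).Coalgebra ⥤ HopfModule A where
  obj Z := functorKObj A Z
  map {Z W} g :=
    { f := g.f ⊚ₘ 𝟙 A
      act_f := by
        change actK A Z.A ≫ (g.f ⊚ₘ 𝟙 A) = ((g.f ⊚ₘ 𝟙 A) ⊚ₘ 𝟙 A) ≫ actK A W.A
        rw [actK, actK, reassoc_of% @circ_assoc_natural, Category.assoc, circ_comp, circ_comp, circ_id,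
          Category.id_comp, Category.comp_id, Category.id_comp, Category.comp_id]
      f_coact := by
        change (g.f ⊚ₘ 𝟙 A) ≫ coactK A W = coactK A Z ≫ ((g.f ⊚ₘ 𝟙 A) ⊛ₘ 𝟙 A)
        rw [coactK, coactK, Category.assoc, ← lambda0_natural, reassoc_of% @circ_comp, reassoc_of% @circ_comp,
          coactI_natural] }
  map_id Z := HopfModule.Hom.ext (circ_id Z.A A)
  map_comp f g := HopfModule.Hom.ext (by
    change ((f.f ≫ g.f) ⊚ₘ 𝟙 A) = (f.f ⊚ₘ 𝟙 A) ≫ (g.f ⊚ₘ 𝟙 A)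
    rw [circ_comp, Category.comp_id])

end K

/-! ### The canonical natural transformation `β` -/

section Beta

variable (A : C) [BimonoidObj A]

/-- The action `Q ∘ A ⟶ Q` of an `A`-module. -/
abbrev actA {A : C} [BimonoidObj A] (Q : (modMonad A).Algebra) : Q.A ⊚ A ⟶ Q.A := Q.a

/-- The component at a right `A`-module `Q` of the canonical natural transformation `β`:
`(Q • I) ∘ A ⟶ (Q • I) ∘ (A • A) ⟶ (Q ∘ A) • (I ∘ A) ≅ (Q ∘ A) • A ⟶ Q • A`. -/
def betaApp (Q : (modMonad A).Algebra) : (Q.A ⊛ 𝕀[C]) ⊚ A ⟶ Q.A ⊛ A :=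
  (𝟙 (Q.A ⊛ 𝕀[C]) ⊚ₘ comul A) ≫ zeta Q.A (𝕀[C]) A A ≫
    (𝟙 (Q.A ⊚ A) ⊛ₘ (λ∘ A).hom) ≫ (actA Q ⊛ₘ 𝟙 A)

/-- The comonad `(-) • A` on `C`, whose coalgebras are the right `A`-comodules. -/
abbrev comodComonad : Comonad C :=
  @rightComoduleComonad C _ TwoMonoidalStructures.bullet A BimonoidObj.comon

/-- The canonical natural transformation `β`, between functors `M_A ⥤ C`. -/
def beta : (modMonad A).forget ⋙ (comonadI C).toFunctor ⋙ (modMonad A).toFunctor ⟶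
    (modMonad A).forget ⋙ (comodComonad A).toFunctor where
  app Q := betaApp A Q
  naturality {Q R} g := by
    have hg : actA Q ≫ g.f = (g.f ⊚ₘ 𝟙 A) ≫ actA R := by
      rw [@MonoidalCategory.tensorHom_id C _ TwoMonoidalStructures.circ]
      exact g.h.symm
    have h := lambda0_natural A g.f
    have e : (actA Q ⊛ₘ 𝟙 A) ≫ (g.f ⊛ₘ 𝟙 A) =
        ((g.f ⊚ₘ 𝟙 A) ⊛ₘ 𝟙 A) ≫ (actA R ⊛ₘ 𝟙 A) := by
      rw [bullet_comp, bullet_comp, hg]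
    have hb (Q : (modMonad A).Algebra) : betaApp A Q = lambda0 A Q.A ≫ (actA Q ⊛ₘ 𝟙 A) := by
      simp only [betaApp, lambda0, Category.assoc]
    have key : ((g.f ⊛ₘ 𝟙 (𝕀[C])) ⊚ₘ 𝟙 A) ≫ betaApp A R = betaApp A Q ≫ (g.f ⊛ₘ 𝟙 A) := by
      rw [hb, hb, reassoc_of% h, Category.assoc, e]
    rw [@MonoidalCategory.tensorHom_id C _ TwoMonoidalStructures.circ,
      @MonoidalCategory.tensorHom_id C _ TwoMonoidalStructures.bullet,
      @MonoidalCategory.tensorHom_id C _ TwoMonoidalStructures.bullet] at key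
    exact key

end Beta

end DuoidalCategory

/-! Let `L : M^I ⥤ M_A` send `Z` to the free module `Z ∘ A`; it has the right adjoint `G = (-) • I`.
Through `β`, the coaction that this adjunction puts on `L W` is the Hopf module coaction of `W ∘ A`
(`map_unit_beta`). Since `β` is invertible, a Hopf module morphism `Z ∘ A ⟶ W ∘ A` is therefore a
morphism of coalgebras for the comonad `G ⋙ L`, and `K` plays the role of the comparison functor of
`L`. As in Beck's theorem, full faithfulness follows once each unit component `W ⟶ G L W` is an
equalizer of the canonical pair `G L W ⇉ G L G L W`.

Only `H`, not `L`, is assumed comonadic. The two are linked by the counit `ε : A ⟶ J`, which gives a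
morphism of monads `(-) ∘ A ⟶ (-) ∘ J`. It extends scalars along `ε` on free modules, where no
coequalizers are needed, and takes `L` to `H`. The image under `L` of the canonical fork is split by
the counit of `L ⊣ G`; extension of scalars makes this a splitting of the image under `H`, and
comonadicity of `H` then makes the fork itself an equalizer (`mono_unit_and_exists_lift`). -/

/-! ### Extension of scalars between free algebras along a morphism of monads. -/

namespace CategoryTheory.Monad

variable {C : Type u} [Category.{v} C] {T S : Monad C}

/-- A morphism of free algebras is the Kleisli extension of its restriction along the unit, and `φ`
respects Kleisli extension because it is natural and compatible with multiplication. Functoriality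
of `freeMapOfHom` rests on this. -/
theorem hom_comp_app_of_map_comp (φ : T ⟶ S) {Y Z : C} (l : T.obj Y ⟶ T.obj Z)
    (hl : T.map l ≫ T.μ.app Z = T.μ.app Y ≫ l) :
    l ≫ φ.app Z = φ.app Y ≫ S.map (T.η.app Y ≫ l ≫ φ.app Z) ≫ S.μ.app Z := by
  have e : l = T.map (T.η.app Y ≫ l) ≫ T.μ.app Z := by
    rw [Functor.map_comp, Category.assoc, hl, ← Category.assoc, T.right_unit]
    exact (Category.id_comp l).symm
  have h := φ.toNatTrans.naturality (T.η.app Y ≫ l ≫ φ.app Z)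
  dsimp only [Functor.id_obj] at h
  rw [← reassoc_of% h]
  conv_lhs => rw [e]
  simp only [Category.assoc, Functor.map_comp, φ.app_μ]

/-- A morphism of monads `T ⟶ S` induces a functor from free `T`-algebras to free `S`-algebras,
here on morphisms. -/
def freeMapOfHom (φ : T ⟶ S) {X Y : C} (k : T.free.obj X ⟶ T.free.obj Y) :
    S.free.obj X ⟶ S.free.obj Y where
  f := S.map (show X ⟶ S.obj Y from T.η.app X ≫ k.f ≫ φ.app Y) ≫ S.μ.app Y
  -- The underlying map is a composite of two algebra morphisms: a free map, and the multiplication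
  -- regarded as a morphism out of a free algebra.
  h := (S.free.map (show X ⟶ S.obj Y from T.η.app X ≫ k.f ≫ φ.app Y) ≫
    ({ f := S.μ.app Y, h := S.assoc Y } : S.free.obj (S.obj Y) ⟶ S.free.obj Y)).h

theorem freeMapOfHom_map (φ : T ⟶ S) {X Y : C} (h : X ⟶ Y) :
    freeMapOfHom φ (T.free.map h) = S.free.map h := by
  ext
  have e : T.η.app X ≫ T.map h ≫ φ.app Y = h ≫ S.η.app Y := by
    rw [← φ.app_η Y]
    exact (T.η.naturality_assoc h _).symm
  change S.map (T.η.app X ≫ T.map h ≫ φ.app Y) ≫ S.μ.app Y = S.map h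
  rw [e, Functor.map_comp, Category.assoc, S.right_unit]
  exact Category.comp_id _

theorem freeMapOfHom_comp (φ : T ⟶ S) {X Y Z : C} (k : T.free.obj X ⟶ T.free.obj Y)
    (l : T.free.obj Y ⟶ T.free.obj Z) :
    freeMapOfHom φ (k ≫ l) = freeMapOfHom φ k ≫ freeMapOfHom φ l := by
  ext
  let k' : T.obj X ⟶ T.obj Y := k.f
  let l' : T.obj Y ⟶ T.obj Z := l.f
  change S.map (T.η.app X ≫ (k' ≫ l') ≫ φ.app Z) ≫ S.μ.app Z =
    (S.map (T.η.app X ≫ k' ≫ φ.app Y) ≫ S.μ.app Y) ≫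
      S.map (T.η.app Y ≫ l' ≫ φ.app Z) ≫ S.μ.app Z
  generalize hm : T.η.app Y ≫ l' ≫ φ.app Z = m
  have e : l' ≫ φ.app Z = φ.app Y ≫ S.map m ≫ S.μ.app Z :=
    hm ▸ hom_comp_app_of_map_comp φ l' l.h
  have h := S.μ.naturality m
  dsimp at h
  rw [Category.assoc, e]
  simp only [Functor.map_comp, Category.assoc, S.assoc]
  rw [reassoc_of% h]

end CategoryTheory.Monad

/-! ### Descent along a left adjoint whose extension of scalars is comonadic. -/

namespace CategoryTheory

open Limits

universe w

variable {C : Type u} [Category.{v} C] {D : Type w} [Category.{v} D] {T S : Monad C}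

/-- If `U ⋙ S.free` is comonadic and `T ⟶ S` is a morphism of monads, then the components of the
unit of an adjunction `U ⋙ T.free ⊣ G` are equalizers of the canonical pairs. -/
theorem mono_unit_and_exists_lift (φ : T ⟶ S) (U : D ⥤ C)
    [ComonadicLeftAdjoint (U ⋙ S.free)] {G : T.Algebra ⥤ D} (adj : U ⋙ T.free ⊣ G) (W : D) :
    Mono (adj.unit.app W) ∧
      ∀ {Z : D} (h : Z ⟶ G.obj ((U ⋙ T.free).obj W)),
        h ≫ G.map ((U ⋙ T.free).map (adj.unit.app W)) =
          h ≫ adj.unit.app (G.obj ((U ⋙ T.free).obj W)) →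
        ∃ f : Z ⟶ W, f ≫ adj.unit.app W = h := by
  let L := U ⋙ T.free
  -- The counit components used below are in general not of the form `L.map f`, so `U ⋙ S.free`
  -- cannot be applied to them. `P` accepts any morphism between free algebras.
  let P {X Y : D} (k : L.obj X ⟶ L.obj Y) :
      (U ⋙ S.free).obj X ⟶ (U ⋙ S.free).obj Y := Monad.freeMapOfHom φ k
  have P_map {X Y : D} (f : X ⟶ Y) : P (L.map f) = (U ⋙ S.free).map f :=
    Monad.freeMapOfHom_map φ (U.map f)
  have P_comp {X Y Z : D} (k : L.obj X ⟶ L.obj Y) (l : L.obj Y ⟶ L.obj Z) :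
      P (k ≫ l) = P k ≫ P l := Monad.freeMapOfHom_comp φ k l
  have P_id (X : D) : P (𝟙 (L.obj X)) = 𝟙 _ := by
    rw [← L.map_id, P_map, Functor.map_id]
  let ι : W ⟶ G.obj (L.obj W) := adj.unit.app W
  let f₁ : G.obj (L.obj W) ⟶ G.obj (L.obj (G.obj (L.obj W))) := G.map (L.map ι)
  let f₂ : G.obj (L.obj W) ⟶ G.obj (L.obj (G.obj (L.obj W))) := adj.unit.app (G.obj (L.obj W))
  have w : ι ≫ f₁ = ι ≫ f₂ := (adj.unit.naturality ι).symm
  let hs : IsSplitEqualizer ((U ⋙ S.free).map f₁) ((U ⋙ S.free).map f₂)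
      ((U ⋙ S.free).map ι) :=
    -- The triangle identities and naturality of the counit split the fork after applying `L`; `P`
    -- preserves these equations.
    { leftRetraction := P (adj.counit.app (L.obj W))
      rightRetraction := P (adj.counit.app (L.obj (G.obj (L.obj W))))
      condition := by rw [← Functor.map_comp, ← Functor.map_comp, w]
      ι_leftRetraction := by
        rw [← P_map, ← P_comp, ← P_id]
        exact congrArg P (adj.left_triangle_components W)
      bottom_rightRetraction := by
        rw [← P_map, ← P_comp, ← P_id]
        exact congrArg P (adj.left_triangle_components _)
      top_rightRetraction := by
        rw [← P_map, ← P_map, ← P_comp, ← P_comp]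
        exact congrArg P (adj.counit.naturality (L.map ι)) }
  have : (U ⋙ S.free).IsCosplitPair f₁ f₂ := ⟨_, _, ⟨hs⟩⟩
  -- A comonadic functor creates, hence reflects, equalizers of pairs that it sends to cosplit
  -- pairs.
  let _ := Comonad.createsFSplitEqualizersOfComonadic (F := U ⋙ S.free) f₁ f₂
  have lim : IsLimit (Fork.ofι ι w) := isLimitOfIsLimitForkMap (U ⋙ S.free) w hs.isEqualizer
  exact ⟨mono_of_isLimit_fork lim, fun h hh => ⟨_, (Fork.IsLimit.lift' lim h hh).2⟩⟩

/-- In the situation of `mono_unit_and_exists_lift`, a morphism between objects in the image of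
`U ⋙ T.free` comes from a morphism in `D` if it commutes with the coactions of the comonad of
the adjunction. -/
theorem exists_map_eq (φ : T ⟶ S) (U : D ⥤ C)
    [ComonadicLeftAdjoint (U ⋙ S.free)] {G : T.Algebra ⥤ D} (adj : U ⋙ T.free ⊣ G) {Z W : D}
    (g : (U ⋙ T.free).obj Z ⟶ (U ⋙ T.free).obj W)
    (hg : g ≫ (U ⋙ T.free).map (adj.unit.app W) =
      (U ⋙ T.free).map (adj.unit.app Z) ≫ (U ⋙ T.free).map (G.map g)) :
    ∃ f : Z ⟶ W, (U ⋙ T.free).map f = g := by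
  obtain ⟨-, hlift⟩ := mono_unit_and_exists_lift φ U adj W
  -- The adjunct of `g` is lifted through the unit. By naturality of the unit, the hypothesis `hg`
  -- says that this adjunct equalizes the canonical pair; comparing adjuncts then identifies the
  -- image of `f` with `g`.
  obtain ⟨f, hf⟩ := hlift (adj.homEquiv _ _ g) (by
    rw [Adjunction.homEquiv_unit, Category.assoc, ← G.map_comp, hg, ← Functor.map_comp]
    exact (adj.unit.naturality (adj.unit.app Z ≫ G.map g)).symm)
  refine ⟨f, (adj.homEquiv _ _).injective ?_⟩
  rw [← hf, Adjunction.homEquiv_unit]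
  exact (adj.unit.naturality f).symm

/-- A left adjoint is faithful as soon as the components of its unit are monomorphisms. -/
theorem faithful_comp_free (φ : T ⟶ S) (U : D ⥤ C)
    [ComonadicLeftAdjoint (U ⋙ S.free)] {G : T.Algebra ⥤ D} (adj : U ⋙ T.free ⊣ G) :
    (U ⋙ T.free).Faithful where
  map_injective {Z W f f'} h := by
    have := (mono_unit_and_exists_lift φ U adj W).1
    rw [← cancel_mono (adj.unit.app W)]
    refine (adj.unit.naturality f).trans (Eq.trans ?_ (adj.unit.naturality f').symm)
    exact congrArg (fun k => adj.unit.app Z ≫ G.map k) h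

end CategoryTheory

/-! ### Hopf modules and the adjunction between `M^I` and `M_A`. -/

namespace DuoidalCategory

variable {C : Type u} [Category.{v} C] [DuoidalCategory C] (A : C) [BimonoidObj A]

/-- The morphism of monads `(-) ∘ A ⟶ (-) ∘ J` induced by the counit of `A`. -/
def counitMonadHom : modMonad A ⟶ monadJ C where
  app X := 𝟙 X ⊚ₘ counit A
  naturality X Y f := by
    have h : (f ⊚ₘ 𝟙 A) ≫ (𝟙 Y ⊚ₘ counit A) = (𝟙 X ⊚ₘ counit A) ≫ (f ⊚ₘ 𝟙 (𝕁[C])) := by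
      rw [circ_comp, circ_comp]
      simp only [Category.id_comp, Category.comp_id]
    rw [@MonoidalCategory.tensorHom_id C _ TwoMonoidalStructures.circ,
      @MonoidalCategory.tensorHom_id C _ TwoMonoidalStructures.circ] at h
    exact h
  app_η X := by
    have h : ((ρ∘ X).inv ≫ (𝟙 X ⊚ₘ one A)) ≫ (𝟙 X ⊚ₘ counit A) =
        (ρ∘ X).inv ≫ (𝟙 X ⊚ₘ tau C) := by
      rw [Category.assoc, circ_comp, BimonoidObj.one_counit, Category.id_comp]
    rw [@MonoidalCategory.id_tensorHom C _ TwoMonoidalStructures.circ _ _ _ (one A),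
      @MonoidalCategory.id_tensorHom C _ TwoMonoidalStructures.circ _ _ _ (tau C)] at h
    exact h
  app_μ X := by
    have h : ((α∘ X A A).hom ≫ (𝟙 X ⊚ₘ mul A)) ≫ (𝟙 X ⊚ₘ counit A) =
        (((𝟙 X ⊚ₘ counit A) ⊚ₘ 𝟙 A) ≫ (𝟙 (X ⊚ 𝕁[C]) ⊚ₘ counit A)) ≫
          (α∘ X (𝕁[C]) (𝕁[C])).hom ≫ (𝟙 X ⊚ₘ varpi C) := by
      rw [Category.assoc, circ_comp, circ_comp, BimonoidObj.mul_counit, Category.id_comp,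
        Category.comp_id, reassoc_of% @circ_assoc_natural, circ_comp, Category.id_comp,
        Category.id_comp]
    rw [@MonoidalCategory.id_tensorHom C _ TwoMonoidalStructures.circ _ _ _ (mul A),
      @MonoidalCategory.id_tensorHom C _ TwoMonoidalStructures.circ _ _ _ (varpi C),
      @MonoidalCategory.tensorHom_id C _ TwoMonoidalStructures.circ] at h
    exact h

/-- The functor `M^I ⥤ M_A` sending an `I`-comodule to the free `A`-module on it. -/
abbrev comoduleToModule : (comonadI C).Coalgebra ⥤ (modMonad A).Algebra :=
  (comonadI C).forget ⋙ (modMonad A).free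

/-- The functor `(-) ∘ A : M^I ⥤ M_A` is left adjoint to `(-) • I`. -/
abbrev comoduleToModuleAdj :
    comoduleToModule A ⊣ (modMonad A).forget ⋙ (comonadI C).cofree :=
  (comonadI C).adj.comp (modMonad A).adj

/-- The morphism `Z ⟶ Z ∘ A` given by the unit of `A`. -/
def unitA (Z : C) : Z ⟶ Z ⊚ A := (ρ∘ Z).inv ≫ (𝟙 Z ⊚ₘ one A)

/-- The adjunction is a composite, so its unit is the unit of the cofree adjunction, namely the
coaction, followed by the cofree image of the unit of the free module adjunction. -/
theorem comoduleToModuleAdj_unit_f (W : (comonadI C).Coalgebra) :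
    ((comoduleToModuleAdj A).unit.app W).f = coactI W ≫ (unitA A W.A ⊛ₘ 𝟙 (𝕀[C])) := by
  rw [@MonoidalCategory.tensorHom_id C _ TwoMonoidalStructures.bullet, unitA,
    @MonoidalCategory.id_tensorHom C _ TwoMonoidalStructures.circ]
  rw [Adjunction.comp_unit_app]
  simp only [Comonad.adj_unit, Monad.adj_unit]
  rfl

theorem unitA_actK (Z : C) : (unitA A Z ⊚ₘ 𝟙 A) ≫ actK A Z = 𝟙 (Z ⊚ A) := by
  let _ := TwoMonoidalStructures.circ (C := C)
  let _ : MonObj A := BimonoidObj.mon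
  have h := (rightModuleMonad A).right_unit Z
  rw [@MonoidalCategory.tensorHom_id C _ TwoMonoidalStructures.circ, actK, unitA,
    @MonoidalCategory.id_tensorHom C _ TwoMonoidalStructures.circ,
    @MonoidalCategory.id_tensorHom C _ TwoMonoidalStructures.circ]
  exact h

theorem betaApp_free (Z : C) :
    betaApp A ((modMonad A).free.obj Z) = lambda0 A (Z ⊚ A) ≫ (actK A Z ⊛ₘ 𝟙 A) := by
  have ha : actA ((modMonad A).free.obj Z) = actK A Z := by
    rw [actK, @MonoidalCategory.id_tensorHom C _ TwoMonoidalStructures.circ]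
    rfl
  simp only [lambda0, Category.assoc, ← ha]
  rfl

/-- Through `β`, the coaction on the free `A`-module `W ∘ A` given by the adjunction between `M^I`
and `M_A` is the Hopf module coaction. -/
theorem map_unit_beta (W : (comonadI C).Coalgebra) :
    ((comoduleToModule A).map ((comoduleToModuleAdj A).unit.app W)).f ≫
      (beta A).app ((comoduleToModule A).obj W) = coactK A W := by
  have h : ((coactI W ≫ (unitA A W.A ⊛ₘ 𝟙 (𝕀[C]))) ⊚ₘ 𝟙 A) ≫ lambda0 A (W.A ⊚ A) ≫
      (actK A W.A ⊛ₘ 𝟙 A) = coactK A W := by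
    have e : (coactI W ≫ (unitA A W.A ⊛ₘ 𝟙 (𝕀[C]))) ⊚ₘ 𝟙 A =
        (coactI W ⊚ₘ 𝟙 A) ≫ ((unitA A W.A ⊛ₘ 𝟙 (𝕀[C])) ⊚ₘ 𝟙 A) := by
      rw [circ_comp, Category.comp_id]
    -- Naturality of `lambda0` moves the unit of `A` next to the action, where the two cancel.
    rw [e, Category.assoc, reassoc_of% @lambda0_natural, bullet_comp, unitA_actK,
      Category.comp_id, bullet_id, Category.comp_id, coactK]
  rw [← betaApp_free, @MonoidalCategory.tensorHom_id C _ TwoMonoidalStructures.circ,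
    ← comoduleToModuleAdj_unit_f] at h
  exact h

variable {A} in
/-- The morphism of `A`-modules underlying a morphism of Hopf modules `Z ∘ A ⟶ W ∘ A`. -/
def moduleHomOfHopfModuleHom {Z W : (comonadI C).Coalgebra}
    (g : (functorK A).obj Z ⟶ (functorK A).obj W) :
    (comoduleToModule A).obj Z ⟶ (comoduleToModule A).obj W where
  f := g.f
  h := by
    let g' : Z.A ⊚ A ⟶ W.A ⊚ A := g.f
    have h : actK A Z.A ≫ g' = (g' ⊚ₘ 𝟙 A) ≫ actK A W.A := g.act_f
    rw [@MonoidalCategory.tensorHom_id C _ TwoMonoidalStructures.circ, actK, actK,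
      @MonoidalCategory.id_tensorHom C _ TwoMonoidalStructures.circ,
      @MonoidalCategory.id_tensorHom C _ TwoMonoidalStructures.circ] at h
    exact h.symm

/-- After composition with `β`, by `map_unit_beta` and naturality of `β`, this becomes the
compatibility of `g` with the Hopf module coactions. Invertibility of `β` enters only here, to
cancel it on the right. -/
theorem moduleHomOfHopfModuleHom_comp_map_unit [IsIso (beta A)] {Z W : (comonadI C).Coalgebra}
    (g : (functorK A).obj Z ⟶ (functorK A).obj W) :
    moduleHomOfHopfModuleHom g ≫
        (comoduleToModule A).map ((comoduleToModuleAdj A).unit.app W) =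
      (comoduleToModule A).map ((comoduleToModuleAdj A).unit.app Z) ≫
        (comoduleToModule A).map
          (((modMonad A).forget ⋙ (comonadI C).cofree).map (moduleHomOfHopfModuleHom g)) := by
  have hn := (beta A).naturality (moduleHomOfHopfModuleHom g)
  let g' : Z.A ⊚ A ⟶ W.A ⊚ A := g.f
  have hg : g' ≫ coactK A W = coactK A Z ≫ (g' ⊛ₘ 𝟙 A) := g.f_coact
  rw [@MonoidalCategory.tensorHom_id C _ TwoMonoidalStructures.bullet, ← map_unit_beta,
    ← map_unit_beta] at hg
  ext
  refine (cancel_mono ((beta A).app ((comoduleToModule A).obj W))).1 ?_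
  refine (Category.assoc _ _ _).trans (hg.trans ?_)
  refine (Category.assoc _ _ _).trans (Eq.trans ?_ (Category.assoc _ _ _).symm)
  exact congrArg (fun k => ((comoduleToModule A).map ((comoduleToModuleAdj A).unit.app Z)).f ≫ k)
    hn.symm

end DuoidalCategory

open DuoidalCategory in
theorem theorem3p9 {C : Type u} [Category.{v} C] [DuoidalCategory C]
    (hsplit : IsIdempotentComplete C)
    (hH : Nonempty (ComonadicLeftAdjoint (DuoidalCategory.functorH C)))
    (A : C) [DuoidalCategory.BimonoidObj A]
    (hbeta : IsIso (DuoidalCategory.beta A)) :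
    (DuoidalCategory.functorK A).Full ∧ (DuoidalCategory.functorK A).Faithful := by
  obtain ⟨_⟩ := hH
  refine ⟨{ map_surjective := fun {Z W} g => ?_ }, { map_injective := fun {Z W f f'} h => ?_ }⟩
  · obtain ⟨f, hf⟩ := exists_map_eq (counitMonadHom A) (comonadI C).forget
      (comoduleToModuleAdj A) (moduleHomOfHopfModuleHom g)
      (moduleHomOfHopfModuleHom_comp_map_unit A g)
    -- `K` and `L` have the same underlying morphism in `C` on `f`, so a preimage under `L` is a
    -- preimage under `K`; faithfulness transfers in the same way.
    refine ⟨f, HopfModule.Hom.ext (Eq.trans ?_ (congrArg Monad.Algebra.Hom.f hf))⟩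
    exact @MonoidalCategory.tensorHom_id C _ TwoMonoidalStructures.circ _ _ f.f A
  · have := faithful_comp_free (counitMonadHom A) (comonadI C).forget (comoduleToModuleAdj A)
    refine (comoduleToModule A).map_injective (Monad.Algebra.Hom.ext ?_)
    have h' : f.f ⊚ₘ 𝟙 A = f'.f ⊚ₘ 𝟙 A := congrArg HopfModule.Hom.f h
    rw [@MonoidalCategory.tensorHom_id C _ TwoMonoidalStructures.circ,
      @MonoidalCategory.tensorHom_id C _ TwoMonoidalStructures.circ] at h'
    exact h'
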